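/- Let $n$ be a natural number and let $\mathbb K$ be $\mathbb R$ or $\mathbb C$. Let $C(\mathbb R^n)$ be the space of continuous functions $\mathbb R^n\to\mathbb K$ with the topology of uniform convergence on compact sets. If $g\in C(\mathbb R^n)\cap L^1(\mathbb R^n)$ and $g\neq 0$, then $$C(\mathbb R^n)=\overline{\operatorname{span}}_{\mathbb K}\{g(\cdot-\mathbf a):\mathbf a\in\mathbb R^n\},$$ where the closure is taken in this topology. In particular, $g$ is not mean-periodic, where a function in $C(\mathbb R^n)$ is called mean-periodic if the linear span of all its translates is not dense in $C(\mathbb R^n)$. -/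

import Mathlib

/-- The translate `x ↦ g (x - a)` of a continuous function `g` on `ℝⁿ`. -/
def translateBy {𝕜 : Type*} [RCLike 𝕜] {n : ℕ} (g : C(EuclideanSpace ℝ (Fin n), 𝕜))
    (a : EuclideanSpace ℝ (Fin n)) : C(EuclideanSpace ℝ (Fin n), 𝕜) where
  toFun x := g (x - a)
  continuous_toFun := by fun_prop

/-- The linear span of all translates of `g`. -/
def translateSpan {𝕜 : Type*} [RCLike 𝕜] {n : ℕ} (g : C(EuclideanSpace ℝ (Fin n), 𝕜)) :
    Submodule 𝕜 C(EuclideanSpace ℝ (Fin n), 𝕜) :=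
  Submodule.span 𝕜 {f | ∃ a : EuclideanSpace ℝ (Fin n), f = translateBy g a}

/-- `g` is mean-periodic if its translates do not span a dense subspace of `C(ℝⁿ)`. The topology
on `C(ℝⁿ)` is the compact-open one, that is, uniform convergence on compact sets. -/
def IsMeanPeriodic {𝕜 : Type*} [RCLike 𝕜] {n : ℕ} (g : C(EuclideanSpace ℝ (Fin n), 𝕜)) : Prop :=
  ¬ Dense (translateSpan g : Set C(EuclideanSpace ℝ (Fin n), 𝕜))

/-! Fix a compact `K` and a continuous linear `L` on `C(K, ℂ)` killing the translates of `g`.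
Convolving `g` with a compactly supported `h` gives `k` whose translates are still killed, and are
Bochner integrable in `C(K, ℂ)`. Integrating them against a character of frequency `ξ` yields `𝓕 k ξ
• characterOn K ξ`, so `L` kills the characters on the nonempty open set where `𝓕 k ≠ 0`. By
analyticity in `ξ` it kills every character, and these span a dense subspace by Stone–Weierstrass;
hence `L = 0`. -/

open MeasureTheory Topology FourierTransform Convolution

section Translates

variable {E : Type*} [NormedAddCommGroup E]

/-- The family of translates of `g`, restricted to `K`, as a continuous map into `C(K, ℂ)`. -/
noncomputable def restrictTranslate (g : C(E, ℂ)) (K : Set E) : C(E, C(K, ℂ)) :=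
  ContinuousMap.curry ⟨fun p : E × K => g (p.2 - p.1), by fun_prop⟩

@[simp]
theorem restrictTranslate_apply (g : C(E, ℂ)) (K : Set E) (a : E) (x : K) :
    restrictTranslate g K a x = g (x - a) := rfl

end Translates

/-! ### Characters: analyticity in the frequency and density -/

section Characters

variable {E : Type*} [NormedAddCommGroup E] [InnerProductSpace ℝ E]

/-- The function `x ↦ 2πi⟪x, ξ⟫` on `K`, as a continuous linear function of `ξ`. -/
noncomputable def characterExponent (K : Set E) [CompactSpace K] : E →L[ℝ] C(K, ℂ) where
  toFun ξ := ⟨fun x => 2 * Real.pi * Complex.I * (inner ℝ (x : E) ξ : ℝ), by fun_prop⟩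
  map_add' ξ η := by ext x; simp [inner_add_right, mul_add]
  map_smul' c ξ := by ext x; simp [inner_smul_right]; ring
  cont := by
    refine ContinuousMap.continuous_of_continuous_uncurry _ ?_
    simp only [Function.uncurry_def, ContinuousMap.coe_mk]
    fun_prop

/-- The character `x ↦ exp(2πi⟪x, ξ⟫)` on `K`. -/
noncomputable def characterOn (K : Set E) (ξ : E) : C(K, ℂ) :=
  ⟨fun x => (𝐞 (inner ℝ (x : E) ξ) : ℂ), by
    have := Real.continuous_fourierChar
    fun_prop⟩

@[simp]
theorem characterOn_apply (K : Set E) (ξ : E) (x : K) :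
    characterOn K ξ x = (𝐞 (inner ℝ (x : E) ξ) : ℂ) := rfl

theorem characterOn_eq_exp (K : Set E) [CompactSpace K] (ξ : E) :
    characterOn K ξ = NormedSpace.exp (characterExponent K ξ) := by
  ext x
  have h := NormedSpace.map_exp (ContinuousMap.evalAlgHom ℂ ℂ x)
    (continuous_eval_const x) (characterExponent K ξ)
  simp only [ContinuousMap.evalAlgHom_apply] at h
  rw [h, ← Complex.exp_eq_exp_ℂ, characterOn_apply, Real.fourierChar_apply]
  congr 1
  simp [characterExponent]
  ring

/-- An exponential in the Banach algebra `C(K, ℂ)` of a continuous linear map of `ξ`. -/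
theorem analyticOnNhd_characterOn (K : Set E) [CompactSpace K] :
    AnalyticOnNhd ℝ (characterOn K) Set.univ := by
  intro ξ _
  rw [show characterOn K = fun ξ => NormedSpace.exp (characterExponent K ξ) from
    funext (characterOn_eq_exp K)]
  exact (NormedSpace.exp_analytic (𝕂 := ℝ) _).comp ((characterExponent K).analyticAt ξ)

/-- The characters span a dense subspace of `C(K, ℂ)`. -/
theorem span_characterOn_topologicalClosure (K : Set E) [CompactSpace K] :
    (Submodule.span ℂ (Set.range (characterOn K))).topologicalClosure = ⊤ := by
  let A : StarSubalgebra ℂ C(K, ℂ) :=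
    { toSubalgebra := Algebra.adjoin ℂ (Set.range (characterOn K))
      star_mem' := by
        change Algebra.adjoin ℂ (Set.range (characterOn K)) ≤
          star (Algebra.adjoin ℂ (Set.range (characterOn K)))
        refine Algebra.adjoin_le ?_
        rintro - ⟨ξ, rfl⟩
        refine Algebra.subset_adjoin ⟨-ξ, ?_⟩
        ext x
        simp [inner_neg_right, AddChar.map_neg_eq_inv] }
  have hA : Subalgebra.toSubmodule A.toSubalgebra =
      Submodule.span ℂ (Set.range (characterOn K)) := by
    apply Algebra.adjoin_eq_span_of_subset
    refine Set.Subset.trans ?_ Submodule.subset_span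
    intro f hf
    refine Submonoid.closure_induction (fun _ => id) ⟨0, ?_⟩ ?_ hf
    · ext x; simp
    · rintro - - - - ⟨ξ, rfl⟩ ⟨η, rfl⟩
      exact ⟨ξ + η, by ext x; simp [inner_add_right, AddChar.map_add_eq_mul]⟩
  have hsep : A.SeparatesPoints := by
    intro x y hxy
    by_contra! hcon
    have hch : ∀ ξ : E, 𝐞 (inner ℝ ((x : E) - y) ξ) = 1 := by
      intro ξ
      have h := hcon _ ⟨characterOn K ξ, Algebra.subset_adjoin ⟨ξ, rfl⟩, rfl⟩
      simp only [characterOn_apply, Circle.coe_inj] at h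
      rw [inner_sub_left, AddChar.map_sub_eq_div, h, div_self']
    have hne : (x : E) - y ≠ 0 := sub_ne_zero.mpr (Subtype.coe_injective.ne hxy)
    have hpos : inner ℝ ((x : E) - y) ((x : E) - y) ≠ 0 := inner_self_ne_zero.mpr hne
    -- The scaling makes the inner product `1/2`, where the character is `-1`.
    have h := hch ((1 / (2 * inner ℝ ((x : E) - y) ((x : E) - y))) • ((x : E) - y))
    rw [inner_smul_right, one_div, mul_inv, mul_assoc, inv_mul_cancel₀ hpos, mul_one] at h
    have h' := congrArg (fun z : Circle => (z : ℂ)) h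
    simp only [Real.fourierChar_apply] at h'
    rw [show ((2 * Real.pi * (2 : ℝ)⁻¹ : ℝ) : ℂ) * Complex.I = Real.pi * Complex.I by
      push_cast; ring, Complex.exp_pi_mul_I] at h'
    norm_num at h'
  rw [← hA]
  exact congr_arg (Subalgebra.toSubmodule <| StarSubalgebra.toSubalgebra ·)
    (ContinuousMap.starSubalgebra_topologicalClosure_eq_top_of_separatesPoints A hsep)

end Characters

/-! ### Smoothing by convolution and the Fourier argument -/

section Convolution

variable {E : Type*} [NormedAddCommGroup E] [InnerProductSpace ℝ E] [FiniteDimensional ℝ E]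
  [MeasurableSpace E] [BorelSpace E]
  {F : Type*} [NormedAddCommGroup F] [NormedSpace ℂ F] [CompleteSpace F]

/-- A nonzero continuous integrable function has a nonzero Fourier transform. -/
theorem exists_fourier_ne_zero {g : E → ℂ} (hc : Continuous g) (hg : Integrable g)
    (hg0 : g ≠ 0) : ∃ ξ, 𝓕 g ξ ≠ 0 := by
  by_contra! h
  have h0 : 𝓕 g = 0 := funext h
  have hinv := hc.fourierInv_fourier_eq hg (by rw [h0]; exact integrable_zero _ _ _)
  apply hg0
  rw [← hinv, h0]
  ext x
  simp [Real.fourierInv_eq]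

/-- There is a continuous compactly supported function whose Fourier transform does not vanish
at a given frequency. -/
theorem exists_compactSupport_fourier_ne_zero (ξ : E) :
    ∃ h : E → ℂ, Continuous h ∧ HasCompactSupport h ∧ 𝓕 h ξ ≠ 0 := by
  let b : ContDiffBump (0 : E) := default
  -- The modulation cancels the Fourier kernel at `ξ`, leaving `∫ b > 0`.
  refine ⟨fun x => (𝐞 (inner ℝ x ξ) : ℂ) * (b x : ℂ), ?_, ?_, ?_⟩
  · have := Real.continuous_fourierChar
    have := b.continuous
    fun_prop
  · refine HasCompactSupport.mul_left ?_
    exact b.hasCompactSupport.comp_left (g := fun r : ℝ => (r : ℂ)) rfl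
  · have : 𝓕 (fun x => (𝐞 (inner ℝ x ξ) : ℂ) * (b x : ℂ)) ξ = ((∫ x, b x : ℝ) : ℂ) := by
      rw [Real.fourier_eq, ← integral_complex_ofReal]
      refine integral_congr_ae (.of_forall fun x => ?_)
      simp [Circle.smul_def, AddChar.map_neg_eq_inv]
    rw [this]
    exact_mod_cast (b.integral_pos (μ := volume)).ne'

/-- A linear map killing the translates of `g` kills those of a convolution `h ⋆ g`. -/
theorem map_restrictTranslate_convolution_eq_zero {g k : C(E, ℂ)} {h : E → ℂ}
    (hc : Continuous h) (hs : HasCompactSupport h)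
    (hk : ∀ x, k x = ∫ b, h b * g (x - b)) (K : Set E) [CompactSpace K]
    (L : C(K, ℂ) →L[ℂ] F) (hL : ∀ a, L (restrictTranslate g K a) = 0) (a : E) :
    L (restrictTranslate k K a) = 0 := by
  have hint : Integrable (fun b => h b • restrictTranslate g K (a + b)) := by
    refine Continuous.integrable_of_hasCompactSupport ?_ hs.smul_right
    have := (restrictTranslate g K).continuous
    fun_prop
  have heq : restrictTranslate k K a = ∫ b, h b • restrictTranslate g K (a + b) := by
    ext x
    rw [ContinuousMap.integral_apply hint, restrictTranslate_apply, hk]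
    simp [sub_sub]
  rw [heq, ← L.integral_comp_comm hint]
  simp [hL]

/-- The translates of `h ⋆ g`, restricted to a compact set, form an integrable family. -/
theorem integrable_restrictTranslate_convolution {g k : C(E, ℂ)} {h : E → ℂ}
    (hg : Integrable g) (hc : Continuous h) (hs : HasCompactSupport h)
    (hk : ∀ x, k x = ∫ b, h b * g (x - b)) (K : Set E) [CompactSpace K] :
    Integrable (fun a => restrictTranslate k K a) := by
  obtain ⟨M, hM⟩ := hs.exists_bound_of_continuous hc
  obtain ⟨r, hr⟩ := hs.isCompact.isBounded.subset_closedBall (0 : E)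
  obtain ⟨s, hK⟩ := (isCompact_iff_compactSpace.mpr ‹_› : IsCompact K).isBounded.subset_closedBall 0
  have hM0 : 0 ≤ M := (norm_nonneg _).trans (hM 0)
  -- `B` dominates `h (x - ·)` simultaneously for all `x ∈ K`, so a convolution with `B` bounds the
  -- sup norm over `K`.
  let B : E → ℝ := (Metric.closedBall (0 : E) (r + s)).indicator fun _ => M
  have hB : Integrable B :=
    (integrable_indicator_iff measurableSet_closedBall).mpr
      (integrableOn_const measure_closedBall_lt_top.ne)
  have hB0 : ∀ y, 0 ≤ B y := fun y => Set.indicator_nonneg (fun _ _ => hM0) y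
  have hconv : Integrable (B ⋆[ContinuousLinearMap.mul ℝ ℝ] fun y => ‖g (-y)‖) :=
    hB.integrable_convolution _ hg.comp_neg.norm
  refine hconv.mono' (restrictTranslate k K).continuous.aestronglyMeasurable
    (.of_forall fun a => ?_)
  have hnn : 0 ≤ (B ⋆[ContinuousLinearMap.mul ℝ ℝ] fun y => ‖g (-y)‖) a :=
    integral_nonneg fun y => mul_nonneg (hB0 y) (norm_nonneg _)
  refine (ContinuousMap.norm_le _ hnn).mpr fun x => ?_
  rw [restrictTranslate_apply, hk]
  calc ‖∫ b, h b * g (x - a - b)‖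
      = ‖∫ y, h (x - y) * g (y - a)‖ := by
        rw [← integral_sub_left_eq_self _ volume (x : E)]
        congr 2 with y
        congr 2
        abel
    _ ≤ ∫ y, B y * ‖g (y - a)‖ := by
        refine norm_integral_le_of_norm_le ?_ (.of_forall fun y => ?_)
        · have : (fun y => B y * ‖g (y - a)‖) = (Metric.closedBall (0 : E) (r + s)).indicator
              fun y => M * ‖g (y - a)‖ := by
            ext y
            simp only [B, Set.indicator_mul_left]
          rw [this]
          exact ((hg.comp_sub_right a).norm.const_mul M).indicator measurableSet_closedBall
        · rw [norm_mul]
          refine mul_le_mul_of_nonneg_right ?_ (norm_nonneg _)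
          by_cases hy : h (x - y) = 0
          · simpa [hy] using hB0 y
          · have h1 : ‖(x : E) - y‖ ≤ r := by
              simpa using hr (subset_tsupport _ hy)
            have h2 : ‖(x : E)‖ ≤ s := by simpa using hK x.2
            have h3 : y ∈ Metric.closedBall (0 : E) (r + s) := by
              rw [mem_closedBall_zero_iff]
              calc ‖y‖ = ‖(x : E) - (x - y)‖ := by rw [sub_sub_cancel]
                _ ≤ ‖(x : E)‖ + ‖(x : E) - y‖ := norm_sub_le _ _
                _ ≤ r + s := by linarith
            simpa [B, Set.indicator_of_mem h3] using hM _
    _ = _ := by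
        simp [convolution_def]

/-- The integral of the modulated translates of `k` is the Fourier transform of `k` times a
character. -/
theorem integral_smul_restrictTranslate {k : C(E, ℂ)} (K : Set E) [CompactSpace K]
    (hk : Integrable (fun a => restrictTranslate k K a)) (ξ : E) :
    ∫ a, (𝐞 (inner ℝ a ξ) : ℂ) • restrictTranslate k K a = 𝓕 (k : E → ℂ) ξ • characterOn K ξ := by
  have hint : Integrable (fun a => (𝐞 (inner ℝ a ξ) : ℂ) • restrictTranslate k K a) := by
    refine hk.norm.mono' (Continuous.aestronglyMeasurable ?_) (.of_forall fun a => ?_)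
    · have := Real.continuous_fourierChar
      have := (restrictTranslate k K).continuous
      fun_prop
    · rw [norm_smul, Circle.norm_coe, one_mul]
  ext x
  rw [ContinuousMap.integral_apply hint, Real.fourier_eq]
  simp only [ContinuousMap.smul_apply, restrictTranslate_apply, smul_eq_mul, characterOn_apply]
  rw [← integral_sub_left_eq_self _ volume (x : E), ← integral_mul_const]
  congr 1 with y
  rw [sub_sub_cancel, inner_sub_left, sub_eq_add_neg, AddChar.map_add_eq_mul, Circle.smul_def]
  push_cast
  rw [smul_eq_mul]
  ring

/-- A continuous linear map on `C(K, ℂ)` killing the translates of a nonzero continuous integrable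
function is zero. -/
theorem eq_zero_of_map_restrictTranslate_eq_zero {g : C(E, ℂ)} (hg : Integrable g) (hg0 : g ≠ 0)
    (K : Set E) [CompactSpace K] (L : C(K, ℂ) →L[ℂ] F)
    (hL : ∀ a, L (restrictTranslate g K a) = 0) : L = 0 := by
  obtain ⟨ξ₀, hξ₀⟩ := exists_fourier_ne_zero g.continuous hg
    (fun h => hg0 (ContinuousMap.coe_injective h))
  obtain ⟨h, hc, hs, hh⟩ := exists_compactSupport_fourier_ne_zero ξ₀
  have hhint : Integrable h := hc.integrable_of_hasCompactSupport hs
  let k : C(E, ℂ) := ⟨h ⋆[ContinuousLinearMap.mul ℂ ℂ] g,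
    hs.continuous_convolution_left _ hc hg.locallyIntegrable⟩
  have hk : ∀ x, k x = ∫ b, h b * g (x - b) := fun x => rfl
  have hkint : Integrable k := hhint.integrable_convolution _ hg
  have hk0 : 𝓕 (k : E → ℂ) ξ₀ ≠ 0 := by
    have := Real.fourier_mul_convolution_eq hhint hg ξ₀
    change 𝓕 (h ⋆[ContinuousLinearMap.mul ℂ ℂ] g) ξ₀ ≠ 0
    rw [this]
    exact mul_ne_zero hh hξ₀
  have hkc : Continuous (𝓕 (k : E → ℂ)) :=
    VectorFourier.fourierIntegral_continuous Real.continuous_fourierChar (L := innerₗ E)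
      continuous_inner hkint
  have hkK := integrable_restrictTranslate_convolution hg hc hs hk K
  have hLk := map_restrictTranslate_convolution_eq_zero hc hs hk K L hL
  have hmul : ∀ ξ, 𝓕 (k : E → ℂ) ξ • L (characterOn K ξ) = 0 := by
    intro ξ
    rw [← map_smul, ← integral_smul_restrictTranslate K hkK]
    rw [← L.integral_comp_comm]
    · simp [hLk]
    · refine hkK.norm.mono' (Continuous.aestronglyMeasurable ?_) (.of_forall fun a => ?_)
      · have := Real.continuous_fourierChar
        have := (restrictTranslate k K).continuous
        fun_prop
      · rw [norm_smul, Circle.norm_coe, one_mul]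
  have hnear : ∀ᶠ ξ in 𝓝 ξ₀, L (characterOn K ξ) = 0 := by
    filter_upwards [hkc.continuousAt.eventually_ne hk0] with ξ hξ
    exact (smul_eq_zero.mp (hmul ξ)).resolve_left hξ
  have han : AnalyticOnNhd ℝ (fun ξ => L (characterOn K ξ)) Set.univ := fun ξ hξ =>
    ((L.restrictScalars ℝ).analyticAt _).comp (analyticOnNhd_characterOn K ξ hξ)
  have hall := han.eqOn_zero_of_preconnected_of_eventuallyEq_zero isPreconnected_univ
    (Set.mem_univ ξ₀) hnear
  have hle : (Submodule.span ℂ (Set.range (characterOn K))).topologicalClosure ≤ L.ker := by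
    refine Submodule.topologicalClosure_minimal _ ?_ L.isClosed_ker
    rw [Submodule.span_le]
    rintro - ⟨ξ, rfl⟩
    exact hall (Set.mem_univ ξ)
  rw [span_characterOn_topologicalClosure] at hle
  ext1 f
  exact hle Submodule.mem_top

theorem span_restrictTranslate_topologicalClosure {g : C(E, ℂ)} (hg : Integrable g) (hg0 : g ≠ 0)
    (K : Set E) [CompactSpace K] :
    (Submodule.span ℂ (Set.range (restrictTranslate g K))).topologicalClosure = ⊤ := by
  set W := (Submodule.span ℂ (Set.range (restrictTranslate g K))).topologicalClosure with hW
  have : IsClosed (W : Set C(K, ℂ)) := Submodule.isClosed_topologicalClosure _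
  -- The quotient map by the closed subspace `W` plays the role of all functionals vanishing on `W`,
  -- so Hahn–Banach is not needed.
  have h := eq_zero_of_map_restrictTranslate_eq_zero hg hg0 K W.mkQL (fun a => by
    refine (Submodule.Quotient.mk_eq_zero W).mpr ?_
    exact Submodule.le_topologicalClosure _ (Submodule.subset_span ⟨a, rfl⟩))
  refine (Submodule.eq_top_iff').mpr fun f => ?_
  exact (Submodule.Quotient.mk_eq_zero W).mp (DFunLike.congr_fun h f)

end Convolution

/-! ### From compact sets to the compact-open topology -/

/-- A function whose restriction to every compact set is a limit of restrictions of elements of `S`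
lies in the closure of `S` for the compact-open topology. -/
theorem ContinuousMap.mem_closure_of_forall_restrict {X Y : Type*} [TopologicalSpace X]
    [TopologicalSpace Y] {S : Set C(X, Y)} {f : C(X, Y)}
    (h : ∀ K : Set X, IsCompact K → f.restrict K ∈ closure (ContinuousMap.restrict K '' S)) :
    f ∈ closure S := by
  have hmono : ∀ K K' : Set X, K ⊆ K' →
      (𝓝 (f.restrict K')).comap (ContinuousMap.restrict K') ≤
        (𝓝 (f.restrict K)).comap (ContinuousMap.restrict K) := by
    intro K K' hKK'
    let i : C(K, K') := ⟨Set.inclusion hKK', continuous_inclusion hKK'⟩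
    have hi : Filter.Tendsto (fun u : C(K', Y) => u.comp i) (𝓝 (f.restrict K'))
        (𝓝 (f.restrict K)) := (ContinuousMap.continuous_precomp i).tendsto (f.restrict K')
    exact Filter.tendsto_iff_comap.mp (hi.comp Filter.tendsto_comap)
  rw [mem_closure_iff_nhds]
  intro t ht
  rw [ContinuousMap.nhds_compactOpen_eq_iInf_nhds_induced] at ht
  obtain ⟨K, hK, u, hu, hut⟩ := (Filter.mem_biInf_of_directed (s := {K : Set X | IsCompact K})
    (fun K hK K' hK' => ⟨K ∪ K', hK.union hK', hmono _ _ Set.subset_union_left,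
      hmono _ _ Set.subset_union_right⟩) ⟨∅, isCompact_empty⟩).mp ht
  obtain ⟨-, hvu, v, hv, rfl⟩ := mem_closure_iff_nhds.mp (h K hK) u hu
  exact ⟨v, hut hvu, hv⟩

theorem dense_translateSpan_complex {n : ℕ} (g : C(EuclideanSpace ℝ (Fin n), ℂ))
    (hg : Integrable g) (hg0 : g ≠ 0) :
    closure (translateSpan g : Set C(EuclideanSpace ℝ (Fin n), ℂ)) = Set.univ := by
  refine Set.eq_univ_of_forall fun f => ContinuousMap.mem_closure_of_forall_restrict fun K hK => ?_
  have : CompactSpace K := isCompact_iff_compactSpace.mp hK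
  have hf : f.restrict K ∈
      (Submodule.span ℂ (Set.range (restrictTranslate g K))).topologicalClosure := by
    rw [span_restrictTranslate_topologicalClosure hg hg0]
    trivial
  refine closure_mono ?_ hf
  let R : C(EuclideanSpace ℝ (Fin n), ℂ) →ₗ[ℂ] C(K, ℂ) :=
    { toFun := ContinuousMap.restrict K, map_add' := fun _ _ => rfl, map_smul' := fun _ _ => rfl }
  change (_ : Set C(K, ℂ)) ⊆ ((translateSpan g).map R : Set C(K, ℂ))
  refine Submodule.span_le.mpr ?_
  rintro - ⟨a, rfl⟩
  exact ⟨translateBy g a, Submodule.subset_span ⟨a, rfl⟩, rfl⟩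

/-- For real `𝕜` the map from `ℂ` is the real part, which is multiplicative only against real
factors. -/
theorem RCLike.map_mul_map {𝕜 : Type*} [RCLike 𝕜] (c : ℂ) (w : 𝕜) :
    RCLike.map ℂ 𝕜 (c * RCLike.map 𝕜 ℂ w) = RCLike.map ℂ 𝕜 c * w := by
  rcases RCLike.I_mul_I (K := 𝕜) with hI | hI
  · have him : RCLike.im w = 0 := RCLike.im_eq_zero hI w
    have hw := RCLike.re_add_im w
    simp only [him, hI, mul_zero, add_zero] at hw
    simp [RCLike.map_apply, him, hI, hw]
  · have hw := RCLike.re_add_im w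
    simp only [RCLike.map_apply]
    simp
    linear_combination (-(c.im : 𝕜) * (RCLike.im w : 𝕜)) * hI +
      ((c.re : 𝕜) + (c.im : 𝕜) * RCLike.I) * hw

theorem proposition6p3 {𝕜 : Type*} [RCLike 𝕜] {n : ℕ} (g : C(EuclideanSpace ℝ (Fin n), 𝕜))
    (hg : MeasureTheory.Integrable (fun x => g x) MeasureTheory.volume) (hg0 : g ≠ 0) :
    closure (translateSpan g : Set C(EuclideanSpace ℝ (Fin n), 𝕜)) = Set.univ ∧
      ¬ IsMeanPeriodic g := by
  suffices h : closure (translateSpan g : Set C(EuclideanSpace ℝ (Fin n), 𝕜)) = Set.univ from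
    ⟨h, not_not_intro (dense_iff_closure_eq.mpr h)⟩
  let ι : C(𝕜, ℂ) := ⟨RCLike.map 𝕜 ℂ, (RCLike.map 𝕜 ℂ).continuous⟩
  let ρ : C(ℂ, 𝕜) := ⟨RCLike.map ℂ 𝕜, (RCLike.map ℂ 𝕜).continuous⟩
  have hρι : ∀ w, ρ (ι w) = w := fun w => by
    have := RCLike.map_mul_map (1 : ℂ) w
    rw [one_mul] at this
    exact this.trans (by simp)
  have hdense := dense_translateSpan_complex (ι.comp g)
    ((RCLike.map 𝕜 ℂ).integrable_comp hg) (fun h0 => hg0 (by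
      ext x
      rw [← hρι (g x), show ι (g x) = 0 from DFunLike.congr_fun h0 x]
      simp [ρ]))
  refine Set.eq_univ_of_forall fun f => ?_
  have hmaps : Set.MapsTo (ContinuousMap.comp ρ)
      (translateSpan (ι.comp g) : Set C(EuclideanSpace ℝ (Fin n), ℂ)) (translateSpan g) := by
    -- As `ρ` need not be `ℂ`-linear, the induction must carry an arbitrary scalar `c`.
    have hsmul : ∀ u ∈ translateSpan (ι.comp g), ∀ c : ℂ, ρ.comp (c • u) ∈ translateSpan g := by
      intro u hu
      induction hu using Submodule.span_induction with
      | mem u hu =>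
        obtain ⟨a, rfl⟩ := hu
        intro c
        have : ρ.comp (c • translateBy (ι.comp g) a) = ρ c • translateBy g a :=
          ContinuousMap.ext fun x => RCLike.map_mul_map c (g (x - a))
        rw [this]
        exact Submodule.smul_mem _ _ (Submodule.subset_span ⟨a, rfl⟩)
      | zero =>
        intro c
        rw [smul_zero, show ρ.comp (0 : C(EuclideanSpace ℝ (Fin n), ℂ)) = 0 from
          ContinuousMap.ext fun x => (RCLike.map ℂ 𝕜).map_zero]
        exact Submodule.zero_mem _
      | add u v _ _ hu hv =>
        intro c
        rw [show ρ.comp (c • (u + v)) = ρ.comp (c • u) + ρ.comp (c • v) from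
          ContinuousMap.ext fun x => by
            simpa [ρ, mul_add] using (RCLike.map ℂ 𝕜).map_add (c * u x) (c * v x)]
        exact Submodule.add_mem _ (hu c) (hv c)
      | smul d u _ hu =>
        intro c
        rw [smul_smul]
        exact hu (c * d)
    intro u hu
    simpa using hsmul u hu 1
  have hf : ι.comp f ∈ closure (translateSpan (ι.comp g) : Set _) := hdense ▸ Set.mem_univ _
  have := map_mem_closure ρ.continuous_postcomp hf hmaps
  rwa [show ρ.comp (ι.comp f) = f from ContinuousMap.ext fun x => hρι (f x)] at this
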